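/- Let $K\subset\mathbb{R}^n$ be a symmetric convex body, i.e. a compact convex set with non-empty interior such that $-K=K$. Write $\|x\|_K=\inf\{\lambda>0 : x\in\lambda K\}$ for its Minkowski functional and $|\cdot|$ for $n$-dimensional Lebesgue measure. Suppose that for some $\tau>0$ the volume $|K\cap(x+\tau K)|$ depends only on $\|x\|_K$, that is, for all $x,y\in\mathbb{R}^n$ with $\|x\|_K=\|y\|_K$ one has $|K\cap(x+\tau K)|=|K\cap(y+\tau K)|$. Then $K$ is strictly convex: for any two distinct points of $K$, the open segment between them lies in the interior of $K$. -/

import Mathlib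

open scoped Pointwise

open MeasureTheory Set Filter Topology

section Lens

variable {E : Type*} [NormedAddCommGroup E] [NormedSpace ℝ E]

/-! If `K` is not strictly convex, some boundary segment from `u` to `v` starts at an extreme point
`u`. As θ ↑ 1, the lens `A` centred at θ(1+τ)u shrinks to `u`, while the one at θ(1+τ)m, m =
(u+v)/2, keeps a segment of fixed length. Averaging the two puts many disjoint translates of A/2
into the lens centred halfway (`measure_lt_of_packing`). That lens is therefore larger than `A`,
although the two centres have equal gauge. -/

/-- The intersection of `K` with the translate by `z` of the dilate `τ • K`. -/
def lens (K : Set E) (τ : ℝ) (z : E) : Set E := K ∩ (z +ᵥ τ • K)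

theorem mem_lens {K : Set E} {τ : ℝ} (hτ : 0 < τ) {z p : E} :
    p ∈ lens K τ z ↔ p ∈ K ∧ τ⁻¹ • (p - z) ∈ K := by
  rw [lens, mem_inter_iff, mem_vadd_set_iff_neg_vadd_mem, mem_smul_set_iff_inv_smul_mem₀ hτ.ne',
    vadd_eq_add, neg_add_eq_sub]

theorem midpoint_mem_lens {K : Set E} (hK : Convex ℝ K) {τ : ℝ} (hτ : 0 < τ) {z w p q : E}
    (hp : p ∈ lens K τ z) (hq : q ∈ lens K τ w) :
    (1 / 2 : ℝ) • (p + q) ∈ lens K τ ((1 / 2 : ℝ) • (z + w)) := by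
  rw [mem_lens hτ] at *
  refine ⟨?_, ?_⟩
  · convert hK hp.1 hq.1 (a := 1 / 2) (b := 1 / 2) (by norm_num) (by norm_num) (by norm_num) using 1
    module
  · convert hK hp.2 hq.2 (a := 1 / 2) (b := 1 / 2) (by norm_num) (by norm_num) (by norm_num) using 1
    module

theorem isClosed_lens {K : Set E} (hK : IsClosed K) {τ : ℝ} (hτ : 0 < τ) (z : E) :
    IsClosed (lens K τ z) := by
  have : lens K τ z = K ∩ (fun p => τ⁻¹ • (p - z)) ⁻¹' K := by
    ext p; exact mem_lens hτ
  rw [this]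
  exact hK.inter (hK.preimage (by fun_prop))

/-- A lens of a symmetric set whose centre is inside the critical radius `1 + τ` has
non-empty interior. -/
theorem nonempty_interior_lens {K : Set E} (hK : Convex ℝ K) (hsymm : ∀ x ∈ K, -x ∈ K)
    (h0 : (0 : E) ∈ interior K) {τ : ℝ} (hτ : 0 < τ) {u : E} (hu : u ∈ K) {θ : ℝ}
    (hθ0 : 0 < θ) (hθ : θ < 1) :
    (interior (lens K τ ((θ * (1 + τ)) • u))).Nonempty := by
  have key : ∀ x ∈ K, θ • x ∈ interior K := fun x hx =>
    hK.combo_interior_self_subset_interior (a := 1 - θ) (b := θ) (by linarith) hθ0.le (by ring)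
      ⟨_, smul_mem_smul_set h0, _, smul_mem_smul_set hx, by simp⟩
  refine ⟨θ • u, mem_interior.2
    ⟨interior K ∩ (fun p => τ⁻¹ • (p - (θ * (1 + τ)) • u)) ⁻¹' interior K, ?_, ?_, ?_⟩⟩
  · rintro p ⟨hp, hp'⟩
    exact (mem_lens hτ).2 ⟨interior_subset hp, interior_subset hp'⟩
  · exact isOpen_interior.inter (isOpen_interior.preimage (by fun_prop))
  · refine ⟨key u hu, ?_⟩
    have : τ⁻¹ • (θ • u - (θ * (1 + τ)) • u) = θ • -u := by
      rw [← sub_smul, smul_smul, smul_neg, ← neg_smul]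
      congr 1
      field_simp
      ring
    rw [mem_preimage, this]
    exact key _ (hsymm u hu)

/-- At the critical radius, the lens centred in the direction of an extreme point is a
single point. -/
theorem eq_of_mem_lens_of_mem_extremePoints {K : Set E} (hsymm : ∀ x ∈ K, -x ∈ K) {τ : ℝ}
    (hτ : 0 < τ) {u p : E} (hu : u ∈ K.extremePoints ℝ) (hp : p ∈ lens K τ ((1 + τ) • u)) :
    p = u := by
  rw [mem_lens hτ] at hp
  -- Weights 1/(1+τ), τ/(1+τ) make `u` a convex combination of `p` and -τ⁻¹(p - (1+τ)u).
  refine hu.2 hp.1 (hsymm _ hp.2) ⟨1 / (1 + τ), τ / (1 + τ), by positivity, by positivity,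
    by field_simp, ?_⟩
  rw [smul_neg, smul_smul, smul_sub, smul_smul, neg_sub]
  have h1 : τ / (1 + τ) * τ⁻¹ = 1 / (1 + τ) := by field_simp
  rw [h1, div_mul_cancel₀ _ (by positivity), one_smul]
  abel

/-- Lenses in the direction of an extreme point shrink to it as the centre approaches the
critical radius. -/
theorem exists_forall_mem_lens_dist_lt {K : Set E} (hK : IsCompact K) (hsymm : ∀ x ∈ K, -x ∈ K)
    {τ : ℝ} (hτ : 0 < τ) {u : E} (hu : u ∈ K.extremePoints ℝ) {η : ℝ} (hη : 0 < η) :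
    ∃ θ : ℝ, 1 / 2 < θ ∧ θ < 1 ∧ ∀ p ∈ lens K τ ((θ * (1 + τ)) • u), dist p u < η := by
  by_contra! h
  obtain ⟨a, -, ha, hlim⟩ := exists_seq_strictMono_tendsto' (show (1 / 2 : ℝ) < 1 by norm_num)
  choose p hp hpu using fun k => h (a k) (ha k).1 (ha k).2
  obtain ⟨q, hq, φ, hφ, hφq⟩ := hK.tendsto_subseq fun k => ((mem_lens hτ).1 (hp k)).1
  have hq' : τ⁻¹ • (q - (1 + τ) • u) ∈ K := by
    have hlim' := hlim.comp hφ.tendsto_atTop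
    refine hK.isClosed.mem_of_tendsto (b := atTop)
      (f := fun k => τ⁻¹ • (p (φ k) - (a (φ k) * (1 + τ)) • u)) ?_
      (Eventually.of_forall fun k => ((mem_lens hτ).1 (hp (φ k))).2)
    have := (hφq.sub ((hlim'.mul_const (1 + τ)).smul_const u)).const_smul τ⁻¹
    rwa [one_mul] at this
  have hqu := eq_of_mem_lens_of_mem_extremePoints hsymm hτ hu ((mem_lens hτ).2 ⟨hq, hq'⟩)
  have hd : η ≤ dist q u :=
    ge_of_tendsto (hφq.dist tendsto_const_nhds) (Eventually.of_forall fun k => hpu (φ k))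
  rw [hqu, dist_self] at hd
  linarith

/-- A lens centred in the direction of the midpoint of a segment in `K` contains segments
parallel to it, of length independent of `θ ≤ 1`. -/
theorem add_smul_mem_lens {K : Set E} (hK : Convex ℝ K) (hsymm : ∀ x ∈ K, -x ∈ K) {τ : ℝ}
    (hτ : 0 < τ) {u v : E} (hu : u ∈ K) (hv : v ∈ K) {θ : ℝ} (hθ0 : 0 ≤ θ) (hθ : θ ≤ 1) {t : ℝ}
    (ht0 : 0 ≤ t) (ht : t ≤ 1 / 2) (htτ : t ≤ τ / 2) :
    θ • ((1 / 2 : ℝ) • (u + v) + t • (v - u)) ∈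
      lens K τ ((θ * (1 + τ)) • (1 / 2 : ℝ) • (u + v)) := by
  have h0 : (0 : E) ∈ K := by
    convert hK hu (hsymm u hu) (a := 1 / 2) (b := 1 / 2) (by norm_num) (by norm_num)
      (by norm_num) using 1
    module
  have hs : ∀ x ∈ K, θ • x ∈ K := fun x hx => hK.smul_mem_of_zero_mem h0 hx ⟨hθ0, hθ⟩
  rw [mem_lens hτ]
  refine ⟨hs _ ?_, ?_⟩
  · convert hK hu hv (a := 1 / 2 - t) (b := 1 / 2 + t) (by linarith) (by linarith) (by ring) using 1
    module
  · have htτ' : t / τ ≤ 1 / 2 := by rw [div_le_iff₀ hτ]; linarith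
    -- Up to the factor -θ this is the rescaled point of the second body, so `t ≤ τ / 2` is needed.
    have h1 : (1 / 2 + t / τ) • u + (1 / 2 - t / τ) • v ∈ K :=
      hK hu hv (by positivity) (by linarith) (by ring)
    convert hs _ (hsymm _ h1) using 1
    match_scalars <;> field_simp <;> ring

/-- A compact convex body that is not strictly convex has an extreme point which is the
endpoint of a non-trivial segment in the boundary. -/
theorem exists_extremePoint_segment_subset_frontier {K : Set E} (hK : Convex ℝ K)
    (hcomp : IsCompact K) (hint : (interior K).Nonempty) (h : ¬ StrictConvex ℝ K) :
    ∃ u ∈ K.extremePoints ℝ, ∃ v ∈ K, v ≠ u ∧ ∀ t ∈ Icc (0 : ℝ) 1,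
      u + t • (v - u) ∈ frontier K := by
  simp only [StrictConvex, Set.Pairwise] at h
  push Not at h
  obtain ⟨x, hx, y, hy, hxy, a, b, ha, hb, hab, hm⟩ := h
  obtain ⟨f, hf⟩ := geometric_hahn_banach_open_point hK.interior isOpen_interior hm
  have hle : ∀ z ∈ K, f z ≤ f (a • x + b • y) := by
    intro z hz
    have hz' : z ∈ closure (interior K) := by
      rw [hK.closure_interior_eq_closure_of_nonempty_interior hint]; exact subset_closure hz
    exact closure_minimal (fun w hw => (hf w hw).le)
      (isClosed_le f.continuous continuous_const) hz'
  have hfm : f (a • x + b • y) = a * f x + b * f y := by simp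
  have hfx : f x = f (a • x + b • y) := by
    refine le_antisymm (hle x hx) ?_
    have := hle y hy
    obtain rfl : b = 1 - a := by linarith
    nlinarith
  have hfy : f y = f (a • x + b • y) := by
    refine le_antisymm (hle y hy) ?_
    have := hle x hx
    obtain rfl : a = 1 - b := by linarith
    nlinarith
  have hexp : IsExposed ℝ K (f.toExposed K) := ContinuousLinearMap.toExposed.isExposed
  have hxF : x ∈ f.toExposed K := ⟨hx, fun z hz => hfx ▸ hle z hz⟩
  have hyF : y ∈ f.toExposed K := ⟨hy, fun z hz => hfy ▸ hle z hz⟩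
  -- An extreme point of an exposed face is extreme in `K`, and the face misses the interior.
  obtain ⟨u, hu⟩ := (hexp.isCompact hcomp).extremePoints_nonempty ⟨x, hxF⟩
  have hvF : ∃ v ∈ f.toExposed K, v ≠ u := by
    by_cases hxu : x = u
    · exact ⟨y, hyF, fun e => hxy (hxu.trans e.symm)⟩
    · exact ⟨x, hxF, hxu⟩
  obtain ⟨v, hv, hvu⟩ := hvF
  refine ⟨u, hexp.isExtreme.extremePoints_subset_extremePoints hu, v, hv.1, hvu, fun t ht => ?_⟩
  have hz : u + t • (v - u) ∈ f.toExposed K :=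
    (hexp.convex hK).add_smul_sub_mem hu.1 hv ht
  refine ⟨subset_closure hz.1, fun hzi => ?_⟩
  exact absurd (hf _ hzi) (not_lt.2 (hfx ▸ hz.2 x hx))

end Lens

section Packing

variable {E : Type*} [NormedAddCommGroup E] [NormedSpace ℝ E] [FiniteDimensional ℝ E]
  [MeasurableSpace E] [BorelSpace E] (μ : Measure E) [μ.IsAddHaarMeasure]

/-- A set containing many disjoint translates of `(1 / 2) • A` has larger volume than `A`. -/
theorem measure_lt_of_packing {A B : Set E} (hA : IsClosed A) (hA0 : μ A ≠ 0) (hAfin : μ A ≠ ⊤)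
    {c d : E} (hdiam : ∀ p ∈ A, ∀ q ∈ A, dist p q < ‖d‖)
    (hsub : ∀ k ∈ Finset.range (2 ^ Module.finrank ℝ E + 1), ∀ p ∈ A,
      (1 / 2 : ℝ) • (p + (c + (k : ℝ) • d)) ∈ B) :
    μ A < μ B := by
  set n := Module.finrank ℝ E
  let T : ℕ → Set E := fun k => ((1 / 2 : ℝ) • (c + (k : ℝ) • d)) +ᵥ ((1 / 2 : ℝ) • A)
  have hT : ∀ k, μ (T k) = ENNReal.ofReal ((1 / 2) ^ n) * μ A := fun k => by
    rw [measure_vadd, Measure.addHaar_smul_of_nonneg _ (by norm_num)]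
  have hmeas : ∀ k, MeasurableSet (T k) := fun k =>
    ((hA.smul_of_ne_zero (by norm_num)).vadd _).measurableSet
  have hdisj : ∀ k l, k ≠ l → Disjoint (T k) (T l) := by
    intro k l hkl
    rw [Set.disjoint_left]
    rintro _ ⟨_, ⟨p, hp, rfl⟩, rfl⟩ ⟨_, ⟨q, hq, rfl⟩, hpq⟩
    simp only [vadd_eq_add] at hpq
    have hpq' : p - q = ((l : ℝ) - k) • d := by
      have h2 : (2 : ℝ) • ((1 / 2 : ℝ) • (c + (l : ℝ) • d) + (1 / 2 : ℝ) • q) =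
          (2 : ℝ) • ((1 / 2 : ℝ) • (c + (k : ℝ) • d) + (1 / 2 : ℝ) • p) := congrArg _ hpq
      linear_combination (norm := module) -h2
    have h3 := hdiam p hp q hq
    rw [dist_eq_norm, hpq', norm_smul] at h3
    have h4 : (1 : ℝ) ≤ ‖(l : ℝ) - k‖ := by
      rw [Real.norm_eq_abs]
      have : (1 : ℤ) ≤ |(l : ℤ) - k| := Int.one_le_abs (by omega)
      exact_mod_cast this
    nlinarith [norm_nonneg d]
  have hsum : ∑ k ∈ Finset.range (2 ^ n + 1), μ (T k) ≤ μ B := by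
    rw [← measure_biUnion_finset (fun k _ l _ hkl => hdisj k l hkl) fun k _ => hmeas k]
    refine measure_mono (iUnion₂_subset fun k hk => ?_)
    rintro _ ⟨_, ⟨p, hp, rfl⟩, rfl⟩
    convert hsub k hk p hp using 1
    simp only [vadd_eq_add]
    module
  refine lt_of_lt_of_le ?_ hsum
  simp only [hT, Finset.sum_const, Finset.card_range, nsmul_eq_mul]
  rw [← mul_assoc]
  -- Each half-size copy has 2⁻ⁿ of the volume, so 2ⁿ + 1 copies suffice.
  have h1 : (1 : ENNReal) < ((2 ^ n + 1 : ℕ) : ENNReal) * ENNReal.ofReal ((1 / 2) ^ n) := by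
    rw [← ENNReal.ofReal_natCast, ← ENNReal.ofReal_mul (by positivity), ← ENNReal.ofReal_one,
      ENNReal.ofReal_lt_ofReal_iff (by positivity)]
    push_cast
    rw [one_div, inv_pow, ← div_eq_mul_inv, lt_div_iff₀ (by positivity)]
    linarith
  calc μ A = 1 * μ A := (one_mul _).symm
    _ < _ := (ENNReal.mul_lt_mul_iff_left hA0 hAfin).2 h1

end Packing

theorem lemma2p3 (n : ℕ) (K : ConvexBody (EuclideanSpace ℝ (Fin n)))
    (hint : (interior (K : Set (EuclideanSpace ℝ (Fin n)))).Nonempty)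
    (hsymm : ∀ x ∈ K, -x ∈ K)
    (hvol : ∃ τ : ℝ, 0 < τ ∧ ∀ x y : EuclideanSpace ℝ (Fin n),
      gauge (K : Set (EuclideanSpace ℝ (Fin n))) x =
        gauge (K : Set (EuclideanSpace ℝ (Fin n))) y →
      MeasureTheory.volume ((K : Set (EuclideanSpace ℝ (Fin n))) ∩
          (x +ᵥ τ • (K : Set (EuclideanSpace ℝ (Fin n))))) =
        MeasureTheory.volume ((K : Set (EuclideanSpace ℝ (Fin n))) ∩
          (y +ᵥ τ • (K : Set (EuclideanSpace ℝ (Fin n)))))) :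
    StrictConvex ℝ (K : Set (EuclideanSpace ℝ (Fin n))) := by
  obtain ⟨τ, hτ, hvol⟩ := hvol
  by_contra hns
  obtain ⟨u, hu, v, hv, hvu, hfr⟩ :=
    exists_extremePoint_segment_subset_frontier K.convex K.isCompact hint hns
  have h0 : (0 : EuclideanSpace ℝ (Fin n)) ∈ interior (K : Set (EuclideanSpace ℝ (Fin n))) := by
    obtain ⟨x, hx⟩ := hint
    exact K.convex.combo_interior_self_subset_interior (a := 1 / 2) (b := 1 / 2) (by norm_num)
      (by norm_num) (by norm_num) ⟨_, smul_mem_smul_set hx, _,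
        smul_mem_smul_set (hsymm x (interior_subset hx)), by simp⟩
  have hg : ∀ t ∈ Icc (0 : ℝ) 1,
      gauge (K : Set (EuclideanSpace ℝ (Fin n))) (u + t • (v - u)) = 1 := fun t ht =>
    (gauge_eq_one_iff_mem_frontier K.convex (mem_interior_iff_mem_nhds.1 h0)).2 (hfr t ht)
  set N := 2 ^ Module.finrank ℝ (EuclideanSpace ℝ (Fin n)) + 1
  set r : ℝ := min (1 / 2) (τ / 2) / N with hr
  have hN0 : (0 : ℝ) < N := by positivity
  have hr0 : 0 < r := by positivity
  have hw : 0 < ‖v - u‖ := norm_pos_iff.2 (sub_ne_zero.2 hvu)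
  -- Any two points of the small lens are then less than r‖v - u‖/2 apart, and this is below the
  -- spacing θr‖v - u‖ because θ > 1/2.
  obtain ⟨θ, hθ0, hθ1, hθ⟩ := exists_forall_mem_lens_dist_lt K.isCompact hsymm hτ hu
    (η := r * ‖v - u‖ / 4) (by positivity)
  have hθpos : 0 < θ := by linarith
  have hs : 0 ≤ θ * (1 + τ) := by positivity
  have hmid : (1 / 2 : ℝ) • ((θ * (1 + τ)) • u + (θ * (1 + τ)) • (1 / 2 : ℝ) • (u + v)) =
      (θ * (1 + τ)) • (u + (1 / 4 : ℝ) • (v - u)) := by module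
  have heq : volume (lens (K : Set (EuclideanSpace ℝ (Fin n))) τ ((θ * (1 + τ)) • u)) =
      volume (lens (K : Set (EuclideanSpace ℝ (Fin n))) τ
        ((θ * (1 + τ)) • (u + (1 / 4 : ℝ) • (v - u)))) := by
    refine hvol _ _ ?_
    rw [gauge_smul_of_nonneg hs, gauge_smul_of_nonneg hs, hg (1 / 4) (by norm_num [mem_Icc])]
    have := hg 0 (by simp)
    rw [zero_smul, add_zero] at this
    rw [this]
  refine heq.not_lt (measure_lt_of_packing volume (isClosed_lens K.isClosed hτ _)
    (Measure.measure_pos_of_nonempty_interior _ (nonempty_interior_lens K.convex hsymm h0 hτ hu.1 hθpos hθ1)).ne'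
    (measure_ne_top_of_subset inter_subset_left K.isCompact.measure_ne_top) (c := θ • (1 / 2 : ℝ) • (u + v)) (d := (θ * r) • (v - u))
    ?_ ?_)
  · intro p hp q hq
    have h1 := hθ p hp
    have h2 := hθ q hq
    have h3 := dist_triangle_right p q u
    rw [norm_smul, Real.norm_of_nonneg (by positivity)]
    nlinarith [mul_pos hr0 hw]
  · intro k hk p hp
    have hkN : (k : ℝ) ≤ N := by exact_mod_cast (Finset.mem_range.1 hk).le
    have hkr : k * r ≤ min (1 / 2) (τ / 2) := by
      rw [hr, mul_div_assoc', div_le_iff₀ hN0, mul_comm]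
      exact mul_le_mul_of_nonneg_left hkN (by positivity)
    rw [← hmid]
    refine midpoint_mem_lens K.convex hτ hp ?_
    convert add_smul_mem_lens K.convex hsymm hτ hu.1 hv hθpos.le hθ1.le (t := k * r)
      (by positivity) (hkr.trans (min_le_left _ _)) (hkr.trans (min_le_right _ _)) using 1
    module
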